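/- Let $X$ be a compact metric space with Borel $\sigma$-algebra $\mathcal B_X$, let $(T^{(m,n)})_{(m,n)\in\mathbb Z^2}$ be an action of the group $\mathbb Z^2$ on $X$ by homeomorphisms, and let $\mu$ be a Borel probability measure on $X$ with $\mu(T^{-(m,n)}A)=\mu(A)$ for all $(m,n)\in\mathbb Z^2$ and $A\in\mathcal B_X$. Let $\beta\in\mathbb R$, $\vec v=(1,\beta)$, and for $b\in(0,\infty)$ and $k\in\mathbb N$ put $$\Lambda^{\vec v}(b)=\{(m,n)\in\mathbb Z^2:\ \beta m-b/2\le n\le \beta m+b/2\},\qquad \Lambda^{\vec v}_k(b)=\Lambda^{\vec v}(b)\cap([0,k-1]\times\mathbb Z).$$ The $\vec v$-directional Kronecker algebra is $$\mathcal K_\mu^{\vec v}=\Bigl\{B\in\mathcal B_X:\ \overline{\{1_B\circ T^{(m,n)}:(m,n)\in\Lambda^{\vec v}(a)\}}\ \text{is compact in } L^2(X,\mathcal B_X,\mu)\Bigr\},$$ where $a\in(0,\infty)$ is arbitrary (the choice of $a$ does not matter). The system $(X,\mathcal B_X,\mu,T)$ is called $\vec v$-weak mixing if $\mathcal K_\mu^{\vec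 v}=\{\emptyset,X\}$ modulo $\mu$-null sets. Then for every $b\in(0,\infty)$ the following statements are equivalent. (a) $(X,\mathcal B_X,\mu,T)$ is $\vec v$-weak mixing. (b) For all $B,C\in\mathcal B_X$ there is a subset $\mathcal Q_{B,C}\subset\Lambda^{\vec v}(b)$ with $$\lim_{k\to\infty}\frac{\#\bigl(\mathcal Q_{B,C}\cap([0,k-1]\times\mathbb Z)\bigr)}{\#\Lambda^{\vec v}_k(b)}=1$$ such that $\lim_{i\to\infty}\mu(T^{-(m_i,n_i)}B\cap C)=\mu(B)\mu(C)$ for every sequence $\{(m_i,n_i)\}_{i=1}^\infty$ in $\mathcal Q_{B,C}$ whose first coordinates are strictly increasing, $m_1<m_2<\cdots$. (c) For all $B,C\in\mathcal B_X$ there is a subset $\mathcal Q_{B,C}\subset\Lambda^{\vec v}(b)$ with $$\lim_{k\to\infty}\frac{\#\bigl(\mathcal Q_{B,C}\cap([0,k-1]\times\mathbb Z)\bigr)}{\#\Lambda^{\vec v}_k(b)}=1$$ such that $\lim_{i\to\infty}\mu(T^{-(m_i,n_i)}B\cap C)=\mu(B)\mu(C)$ for every sequence $\{(m_i,n_i)\}_{i=1}^\infty$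 of pairwise distinct elements of $\mathcal Q_{B,C}$. -/

import Mathlib

open MeasureTheory Filter Topology

/-- The strip `Λ^v(b) = {(m, n) ∈ ℤ² : β m - b/2 ≤ n ≤ β m + b/2}` around the line through the
origin with direction `v = (1, β)`. -/
def directionStrip (β b : ℝ) : Set (ℤ × ℤ) :=
  {p | β * (p.1 : ℝ) - b / 2 ≤ (p.2 : ℝ) ∧ (p.2 : ℝ) ≤ β * (p.1 : ℝ) + b / 2}

/-- The vertical band `[0, k - 1] × ℤ`. -/
def verticalBand (k : ℕ) : Set (ℤ × ℤ) :=
  {p | 0 ≤ p.1 ∧ p.1 ≤ (k : ℤ) - 1}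

/-- `Λ_k^v(b) = Λ^v(b) ∩ ([0, k - 1] × ℤ)`. -/
def directionStripTrunc (β b : ℝ) (k : ℕ) : Set (ℤ × ℤ) :=
  directionStrip β b ∩ verticalBand k

/-- `Λ_k^v(b)` is a finite set, so that its `ncard` is its number of elements. -/
theorem directionStripTrunc_finite (β b : ℝ) (k : ℕ) : (directionStripTrunc β b k).Finite := by
  have h : directionStripTrunc β b k ⊆
      ⋃ m ∈ Set.Icc (0 : ℤ) ((k : ℤ) - 1),
        (fun n : ℤ => (m, n)) '' Set.Icc ⌈β * (m : ℝ) - b / 2⌉ ⌊β * (m : ℝ) + b / 2⌋ := by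
    rintro ⟨m, n⟩ ⟨⟨h1, h2⟩, h3, h4⟩
    simp only [Set.mem_iUnion]
    exact ⟨m, ⟨h3, h4⟩, n, ⟨Int.ceil_le.mpr h1, Int.le_floor.mpr h2⟩, rfl⟩
  exact ((Set.finite_Icc _ _).biUnion fun _ _ => (Set.finite_Icc _ _).image _).subset h

/-- The set `Q` has relative density one in the strip `Λ^v(b)`:
`#(Q ∩ ([0, k - 1] × ℤ)) / #(Λ_k^v(b)) → 1` as `k → ∞`. It is used for `Q ⊆ Λ^v(b)`. -/
def HasStripDensityOne (β b : ℝ) (Q : Set (ℤ × ℤ)) : Prop :=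
  Tendsto (fun k : ℕ =>
      ((Q ∩ verticalBand k).ncard : ℝ) / ((directionStripTrunc β b k).ncard : ℝ))
    atTop (𝓝 1)

section MeasurePreserving

variable {X : Type*} [MeasurableSpace X] [AddAction (ℤ × ℤ) X] [MeasurableConstVAdd (ℤ × ℤ) X]

/-- The Koopman operator `U_T^g f = f ∘ T^g` on the complex Hilbert space `L²(X, μ)`, where
`T^g x = g +ᵥ x` is the given `ℤ²`-action. -/
noncomputable def koopman (μ : Measure X) [VAddInvariantMeasure (ℤ × ℤ) X μ] (g : ℤ × ℤ) :
    Lp ℂ 2 μ →ₗᵢ[ℂ] Lp ℂ 2 μ :=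
  Lp.compMeasurePreservingₗᵢ ℂ (fun x : X => g +ᵥ x) (measurePreserving_vadd g μ)

/-- The directional Kronecker algebra of the direction `v = (1, β)`, computed with the strip of
width `b`: all measurable sets `B` such that the closure of `{U_T^g 1_B : g ∈ Λ^v(b)}` is compact
in `L²(X, μ)`. -/
def directionalKronecker (μ : Measure X) [IsFiniteMeasure μ] [VAddInvariantMeasure (ℤ × ℤ) X μ]
    (β b : ℝ) : Set (Set X) :=
  {B | ∃ hB : MeasurableSet B,
    IsCompact (closure ((fun g : ℤ × ℤ =>
      koopman μ g (indicatorConstLp 2 hB (measure_ne_top μ B) (1 : ℂ))) '' directionStrip β b))}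

/-- Weak mixing in the direction `v = (1, β)`: the directional Kronecker algebra is the trivial
algebra `{∅, X}`, where measurable sets are identified if they differ by a null set. -/
def IsDirectionalWeakMixing (μ : Measure X) [IsFiniteMeasure μ]
    [VAddInvariantMeasure (ℤ × ℤ) X μ] (β b : ℝ) : Prop :=
  ∀ B ∈ directionalKronecker μ β b, B =ᵐ[μ] (∅ : Set X) ∨ B =ᵐ[μ] (Set.univ : Set X)

/-- Convergence along the sequence `s i = (m_i, n_i)` of
`μ(T^{-(m_i, n_i)} B ∩ C)` to `μ(B) μ(C)`. -/
def MixesAlong (μ : Measure X) (B C : Set X) (s : ℕ → ℤ × ℤ) : Prop :=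
  Tendsto (fun i : ℕ => μ.real (((fun x : X => s i +ᵥ x) ⁻¹' B) ∩ C)) atTop
    (𝓝 (μ.real B * μ.real C))

end MeasurePreserving

/-! Weak mixing gives mixing along a density-one set because the orbit of `f = 1_B - μ(B)`
decorrelates on average. Vectors with totally bounded orbit along the strip are constants under weak
mixing (`IsDirectionalWeakMixing.exists_eq_const`), so `f` is orthogonal to all of them. It remains
to show that `|⟨ψ, U_g f⟩|²` averages to zero over the truncated strips
(`tendsto_average_inner_sq_zero`).

The strip is not a group, so no ergodic theorem applies directly. Instead, `v_k = k⁻¹ ∑ ⟨U_g f, ψ⟩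
U_g f` is given a weak limit `w` along an ultrafilter. By Cauchy–Schwarz, `|⟨U_h w, y⟩|² ≤ C q(y)`
for all `h` in the strip, where `q` is a limiting average over the strip of double width. Bessel's
inequality bounds the trace of `q`, so `q` is small off a finite-dimensional subspace and the orbit
of `w` is totally bounded. Then `w` is orthogonal to every `U_g f`, hence `w = 0`, and `⟨v_k, ψ⟩`,
which is the average in question, tends to zero. A Koopman–von Neumann argument extracts the
density-one set.

Conversely, if `1_B` has totally bounded orbit, a finite net of orbit points is fixed. Density-one
mixing yields one `g` in the strip almost independent of every net point, while `U_g 1_B` is close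
to one of them. So `μ(B)` is close to `μ(B)²`, and `μ(B) ∈ {0, 1}`. -/

/-! ### Counting lattice points in strips. -/

/-- The points of the strip `Λ^v(b)` whose first coordinate lies in the finite set `S`. -/
noncomputable def stripFinset (β b : ℝ) (S : Finset ℤ) : Finset (ℤ × ℤ) :=
  S.biUnion fun m =>
    (Finset.Icc ⌈β * (m : ℝ) - b / 2⌉ ⌊β * (m : ℝ) + b / 2⌋).image (Prod.mk m)

theorem mem_stripFinset {β b : ℝ} {S : Finset ℤ} {p : ℤ × ℤ} :
    p ∈ stripFinset β b S ↔ p ∈ directionStrip β b ∧ p.1 ∈ S := by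
  obtain ⟨m, n⟩ := p
  simp only [stripFinset, Finset.mem_biUnion, Finset.mem_image, Finset.mem_Icc, Int.ceil_le,
    Int.le_floor, directionStrip, Set.mem_ofPred_eq, Prod.mk.injEq]
  constructor
  · rintro ⟨m', h, n', h', rfl, rfl⟩
    exact ⟨h', h⟩
  · rintro ⟨h', h⟩
    exact ⟨m, h, n, h', rfl, rfl⟩

theorem card_stripFinset_le {β b : ℝ} (hb : 0 < b) (S : Finset ℤ) :
    ((stripFinset β b S).card : ℝ) ≤ (b + 1) * S.card := by
  have h1 : ((stripFinset β b S).card : ℝ) ≤ ∑ _m ∈ S, (b + 1) := by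
    refine (Nat.cast_le.mpr Finset.card_biUnion_le).trans ?_
    push_cast
    refine Finset.sum_le_sum fun m _ => ?_
    refine (Nat.cast_le.mpr Finset.card_image_le).trans ?_
    rw [Int.card_Icc]
    have h2 : ((⌊β * (m : ℝ) + b / 2⌋ + 1 - ⌈β * (m : ℝ) - b / 2⌉ : ℤ) : ℝ) ≤ b + 1 := by
      push_cast
      linarith [Int.floor_le (β * (m : ℝ) + b / 2), Int.le_ceil (β * (m : ℝ) - b / 2)]
    have h3 : (((⌊β * (m : ℝ) + b / 2⌋ + 1 - ⌈β * (m : ℝ) - b / 2⌉).toNat : ℤ) : ℝ)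
        = ((max (⌊β * (m : ℝ) + b / 2⌋ + 1 - ⌈β * (m : ℝ) - b / 2⌉) 0 : ℤ) : ℝ) := by
      rw [Int.toNat_eq_max]
    rw [Int.cast_natCast] at h3
    rw [h3, Int.cast_max, Int.cast_zero]
    exact max_le h2 (by linarith)
  rw [Finset.sum_const, nsmul_eq_mul] at h1
  linarith

theorem coe_stripFinset_Ico (β b : ℝ) (k : ℕ) :
    (stripFinset β b (Finset.Ico 0 (k : ℤ)) : Set (ℤ × ℤ)) = directionStripTrunc β b k := by
  ext p
  rw [Finset.mem_coe, mem_stripFinset, Finset.mem_Ico]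
  simp only [directionStripTrunc, verticalBand, Set.mem_inter_iff, Set.mem_ofPred_eq]
  refine and_congr_right fun _ => ?_
  omega

theorem ncard_directionStripTrunc (β b : ℝ) (k : ℕ) :
    (directionStripTrunc β b k).ncard = (stripFinset β b (Finset.Ico 0 (k : ℤ))).card := by
  rw [← coe_stripFinset_Ico, Set.ncard_coe_finset]

theorem card_stripFinset_Ico_le {β b : ℝ} (hb : 0 < b) (k : ℕ) :
    ((stripFinset β b (Finset.Ico 0 (k : ℤ))).card : ℝ) ≤ (b + 1) * k := by
  simpa using card_stripFinset_le (β := β) hb (Finset.Ico 0 (k : ℤ))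

theorem mem_directionStrip_iff_abs {β b : ℝ} {p : ℤ × ℤ} :
    p ∈ directionStrip β b ↔ |(p.2 : ℝ) - β * p.1| ≤ b / 2 := by
  rw [abs_le, directionStrip, Set.mem_ofPred_eq]
  constructor <;> rintro ⟨h1, h2⟩ <;> constructor <;> linarith

theorem add_mem_directionStrip {β b c : ℝ} {p q : ℤ × ℤ} (hp : p ∈ directionStrip β b)
    (hq : q ∈ directionStrip β c) : p + q ∈ directionStrip β (b + c) := by
  rw [mem_directionStrip_iff_abs] at *
  have : ((p + q).2 : ℝ) - β * (p + q).1 = (p.2 - β * p.1) + (q.2 - β * q.1) := by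
    simp only [Prod.fst_add, Prod.snd_add]
    push_cast
    ring
  rw [this]
  linarith [abs_add_le ((p.2 : ℝ) - β * p.1) (q.2 - β * q.1)]

/-- A strip is covered by finitely many translates of any other strip in the same direction. -/
theorem exists_finset_translates_cover (β : ℝ) {a : ℝ} (b : ℝ) (ha : 0 < a) :
    ∃ F : Finset (ℤ × ℤ), ∀ p ∈ directionStrip β b, ∃ f ∈ F, p - f ∈ directionStrip β a := by
  classical
  -- The offset `t` is additive and strips are preimages of symmetric intervals, so covering by
  -- translates reduces to a finite net of offsets.
  set t : ℤ × ℤ → ℝ := fun p => (p.2 : ℝ) - β * p.1 with ht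
  have hsub : t '' directionStrip β b ⊆ Set.Icc (-(b / 2)) (b / 2) := by
    rintro _ ⟨p, hp, rfl⟩
    exact abs_le.mp (mem_directionStrip_iff_abs.mp hp)
  have htb : TotallyBounded (t '' directionStrip β b) :=
    (isCompact_Icc.totallyBounded).subset hsub
  obtain ⟨s, hs, hfin, hcov⟩ :=
    totallyBounded_iff_subset.mp htb _ (Metric.dist_mem_uniformity (half_pos ha))
  obtain ⟨F, hF, hFs⟩ := Set.subset_image_iff.mp hs
  -- For rational `β` the offset has infinite fibres; one lattice point is kept per net point.
  obtain ⟨G, hGF, hG⟩ := Set.exists_subset_bijOn F t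
  have hGfin : G.Finite := by
    refine Set.Finite.of_finite_image (f := t) ?_ hG.injOn
    rw [hG.image_eq, hFs]
    exact hfin
  refine ⟨hGfin.toFinset, fun p hp => ?_⟩
  have h1 := hcov ⟨p, hp, rfl⟩
  simp only [Set.mem_iUnion] at h1
  obtain ⟨y, hy, hpy⟩ := h1
  rw [← hFs, ← hG.image_eq] at hy
  obtain ⟨f, hf, rfl⟩ := hy
  refine ⟨f, by simpa using hf, ?_⟩
  rw [mem_directionStrip_iff_abs]
  have h2 : |t p - t f| < a / 2 := by simpa [Real.dist_eq] using hpy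
  have h3 : ((p - f).2 : ℝ) - β * (p - f).1 = t p - t f := by
    simp only [ht, Prod.fst_sub, Prod.snd_sub]
    push_cast
    ring
  rw [h3]
  exact h2.le

/-- The truncated strips have at least linearly growing cardinality. -/
theorem exists_linear_le_card_stripFinset (β : ℝ) {b : ℝ} (hb : 0 < b) :
    ∃ c : ℝ, 0 < c ∧ ∀ᶠ k : ℕ in atTop,
      c * k ≤ (stripFinset β b (Finset.Ico 0 (k : ℤ))).card := by
  classical
  obtain ⟨F, hF⟩ := exists_finset_translates_cover β 1 hb
  obtain ⟨N, hN⟩ : ∃ N : ℕ, ∀ f ∈ F, |f.1| ≤ N := by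
    refine ⟨F.sup fun f => f.1.natAbs, fun f hf => ?_⟩
    rw [Int.abs_eq_natAbs]
    exact_mod_cast Finset.le_sup (f := fun f : ℤ × ℤ => f.1.natAbs) hf
  set L : ℕ → ℕ := fun k => (stripFinset β b (Finset.Ico 0 (k : ℤ))).card with hL
  -- A narrow strip may miss columns, but the strip of width `1` meets each one, at `(m, round (β
  -- m))`. Subtracting a suitable `f ∈ F` moves this point into the strip of width `b`, at most `N`
  -- columns outside `[0, k)`.
  have key : ∀ k : ℕ, (k : ℝ) ≤ F.card * (L k + (b + 1) * (2 * N)) := by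
    intro k
    set A := stripFinset β b (Finset.Ico 0 (k : ℤ))
    set A' := stripFinset β b (Finset.Ico (-(N : ℤ)) 0 ∪ Finset.Ico (k : ℤ) (k + N))
    have hA' : (A'.card : ℝ) ≤ (b + 1) * (2 * N) := by
      refine (card_stripFinset_le hb _).trans ?_
      have : ((Finset.Ico (-(N : ℤ)) 0 ∪ Finset.Ico (k : ℤ) (k + N)).card : ℝ) ≤ 2 * N := by
        have := Finset.card_union_le (Finset.Ico (-(N : ℤ)) 0) (Finset.Ico (k : ℤ) (k + N))
        simp only [Int.card_Ico] at this
        have h2 : (Finset.Ico (-(N : ℤ)) 0 ∪ Finset.Ico (k : ℤ) (k + N)).card ≤ 2 * N := by omega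
        exact_mod_cast h2
      gcongr
    have hmap : ∀ m : ℤ, ((m, round (β * m)) : ℤ × ℤ) ∈ directionStrip β 1 := by
      intro m
      rw [mem_directionStrip_iff_abs, abs_sub_comm]
      exact abs_sub_round (β * m)
    have hsub : (Finset.Ico 0 (k : ℤ)).image (fun m : ℤ => ((m, round (β * m)) : ℤ × ℤ)) ⊆
        (F ×ˢ (A ∪ A')).image fun x => x.2 + x.1 := by
      intro p hp
      obtain ⟨m, hm, rfl⟩ := Finset.mem_image.mp hp
      obtain ⟨f, hf, hpf⟩ := hF _ (hmap m)
      refine Finset.mem_image.mpr ⟨(f, (m, round (β * m)) - f), ?_, by simp⟩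
      rw [Finset.mem_product]
      refine ⟨hf, ?_⟩
      have h1 := abs_le.mp (hN f hf)
      rw [Finset.mem_Ico] at hm
      simp only [A, A', Finset.mem_union, mem_stripFinset, Finset.mem_Ico, Prod.fst_sub]
      by_cases h : 0 ≤ m - f.1 ∧ m - f.1 < k
      · exact Or.inl ⟨hpf, h⟩
      · exact Or.inr ⟨hpf, by omega⟩
    have hcard := (Finset.card_le_card hsub).trans Finset.card_image_le
    rw [Finset.card_image_of_injective _ (fun m m' h => (Prod.mk.inj h).1), Int.card_Ico,
      Finset.card_product] at hcard
    have h2 : k ≤ F.card * (A.card + A'.card) := by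
      refine le_trans (by omega) (hcard.trans (Nat.mul_le_mul_left _ (Finset.card_union_le _ _)))
    have h3 : (k : ℝ) ≤ F.card * (A.card + A'.card) := by exact_mod_cast h2
    refine h3.trans ?_
    gcongr
  have hFpos : (0 : ℝ) < F.card := by
    have h1 := key 1
    by_contra h
    have : (F.card : ℝ) = 0 := le_antisymm (not_lt.mp h) (Nat.cast_nonneg _)
    rw [this] at h1
    norm_num at h1
  -- For large `k` the boundary term absorbs at most half of `k`, whence the factor `2`.
  refine ⟨1 / (2 * F.card), by positivity, ?_⟩
  filter_upwards [eventually_ge_atTop ⌈2 * (F.card * ((b + 1) * (2 * N)))⌉₊] with k hk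
  have h1 := key k
  have h2 := Nat.le_of_ceil_le hk
  rw [div_mul_eq_mul_div, div_le_iff₀ (by positivity)]
  nlinarith

/-! ### Total boundedness, weak limits and trace bounds in Hilbert space. -/

theorem totallyBounded_of_forall_exists_totallyBounded {E : Type*} [PseudoMetricSpace E]
    {A : Set E}
    (h : ∀ ε > 0, ∃ T : Set E, TotallyBounded T ∧ ∀ a ∈ A, ∃ t ∈ T, dist a t ≤ ε) :
    TotallyBounded A := by
  rw [Metric.totallyBounded_iff]
  intro ε hε
  obtain ⟨T, hT, hA⟩ := h (ε / 2) (half_pos hε)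
  obtain ⟨s, hs, hcov⟩ := Metric.totallyBounded_iff.mp hT (ε / 2) (half_pos hε)
  refine ⟨s, hs, fun a ha => ?_⟩
  obtain ⟨t, ht, hat⟩ := hA a ha
  have h1 := hcov ht
  simp only [Set.mem_iUnion, Metric.mem_ball] at h1 ⊢
  obtain ⟨y, hy, hty⟩ := h1
  exact ⟨y, hy, by linarith [dist_triangle a t y]⟩

theorem isCompact_closure_iff_totallyBounded {E : Type*} [UniformSpace E] [CompleteSpace E]
    {A : Set E} : IsCompact (closure A) ↔ TotallyBounded A := by
  rw [isCompact_iff_totallyBounded_isComplete, totallyBounded_closure]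
  exact ⟨fun h => h.1, fun h => ⟨h, isClosed_closure.isComplete⟩⟩

section Hilbert

variable {H : Type*} [NormedAddCommGroup H] [InnerProductSpace ℂ H]

/-- A bounded sequence in a Hilbert space converges weakly along every ultrafilter. -/
theorem exists_weak_limit_ultrafilter [CompleteSpace H] {ι : Type*} (𝒰 : Ultrafilter ι)
    (v : ι → H) {C : ℝ} (hv : ∀ k, ‖v k‖ ≤ C) :
    ∃ w : H, ∀ y, Tendsto (fun k => inner ℂ (v k) y) 𝒰 (𝓝 (inner ℂ w y)) := by
  set φ : ι → WeakDual ℂ H := fun k =>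
    StrongDual.toWeakDual (InnerProductSpace.toDual ℂ H (v k)) with hφ
  have hcomp := WeakDual.isCompact_closedBall (𝕜 := ℂ) (E := H) 0 C
  have hmem : ∀ k, φ k ∈ WeakDual.toStrongDual ⁻¹' Metric.closedBall (0 : StrongDual ℂ H) C := by
    intro k
    rw [Set.mem_preimage, mem_closedBall_zero_iff]
    exact ((InnerProductSpace.toDual ℂ H).norm_map (v k)).trans_le (hv k)
  obtain ⟨ψ, -, hψ⟩ := hcomp.ultrafilter_le_nhds (𝒰.map φ)
    (le_principal_iff.mpr (Filter.mem_map.mpr (Filter.univ_mem' hmem)))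
  refine ⟨(InnerProductSpace.toDual ℂ H).symm (WeakDual.toStrongDual ψ), fun y => ?_⟩
  rw [InnerProductSpace.toDual_symm_apply]
  exact ((WeakDual.eval_continuous (𝕜 := ℂ) (E := H) y).tendsto ψ).comp
    (show Tendsto φ 𝒰 (𝓝 ψ) from hψ)

/-- If a nonnegative quadratic quantity has bounded sums over orthonormal families, it is small on
the orthogonal complement of a finite-dimensional subspace. -/
theorem exists_finiteDimensional_forall_orthogonal_le (q : H → ℝ) {K : ℝ}
    (hq : ∀ (c : ℂ) (y : H), q (c • y) = ‖c‖ ^ 2 * q y)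
    (hK : ∀ s : Finset H, Orthonormal ℂ ((↑) : s → H) → ∑ y ∈ s, q y ≤ K)
    {ε : ℝ} (hε : 0 < ε) :
    ∃ F : Submodule ℂ H, FiniteDimensional ℂ F ∧ ∀ y ∈ Fᗮ, q y ≤ ε * ‖y‖ ^ 2 := by
  classical
  by_contra! hcon
  -- If the claim fails, a normalised bad vector orthogonal to the current span can always be added;
  -- once `n * ε > K` the trace bound is violated.
  have step : ∀ n : ℕ, ∃ s : Finset H, s.card = n ∧ Orthonormal ℂ ((↑) : s → H) ∧
      ∀ y ∈ s, ε ≤ q y := by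
    intro n
    induction n with
    | zero =>
      exact ⟨∅, rfl, ⟨fun x => absurd x.2 (Finset.notMem_empty _),
        fun x => absurd x.2 (Finset.notMem_empty _)⟩, fun y hy => absurd hy (Finset.notMem_empty _)⟩
    | succ n ih =>
      obtain ⟨s, hcard, hs, hqs⟩ := ih
      obtain ⟨y, hy, hqy⟩ := hcon (Submodule.span ℂ (s : Set H))
        (FiniteDimensional.span_finset ℂ s)
      have hy0 : y ≠ 0 := by
        rintro rfl
        have := hq 0 0
        simp at this
        rw [this] at hqy
        simp at hqy
      have hny : ‖y‖ ≠ 0 := norm_ne_zero_iff.mpr hy0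
      set z : H := ((‖y‖⁻¹ : ℝ) : ℂ) • y with hz
      have hzn : ‖z‖ = 1 := by
        rw [hz, norm_smul, Complex.norm_real, norm_inv, norm_norm, inv_mul_cancel₀ hny]
      have hort : ∀ x ∈ s, inner ℂ x z = 0 := by
        intro x hx
        rw [hz, inner_smul_right,
          (Submodule.mem_orthogonal _ _).mp hy x (Submodule.subset_span hx), mul_zero]
      have hzs : z ∉ s := by
        intro h
        have := hort z h
        rw [inner_self_eq_norm_sq_to_K, hzn] at this
        norm_num at this
      refine ⟨insert z s, by rw [Finset.card_insert_of_notMem hzs, hcard], ⟨?_, ?_⟩, ?_⟩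
      · rintro ⟨x, hx⟩
        rcases Finset.mem_insert.mp hx with rfl | hx
        · exact hzn
        · exact hs.1 ⟨x, hx⟩
      · rintro ⟨x, hx⟩ ⟨x', hx'⟩ hne
        have hne' : x ≠ x' := fun h => hne (Subtype.ext h)
        rcases Finset.mem_insert.mp hx with h | h <;>
          rcases Finset.mem_insert.mp hx' with h' | h'
        · exact absurd (h.trans h'.symm) hne'
        · simp only [h]
          exact inner_eq_zero_symm.mp (hort x' h')
        · simp only [h']
          exact hort x h
        · exact hs.2 (i := ⟨x, h⟩) (j := ⟨x', h'⟩) (fun h => hne' (Subtype.mk.inj h))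
      · intro x hx
        rcases Finset.mem_insert.mp hx with rfl | hx
        · rw [hz, hq, Complex.norm_real, norm_inv, norm_norm, inv_pow, inv_mul_eq_div,
            le_div_iff₀ (by positivity)]
          exact hqy.le
        · exact hqs x hx
  obtain ⟨n, hn⟩ := exists_nat_gt (K / ε)
  obtain ⟨s, hcard, hs, hqs⟩ := step n
  have h1 := hK s hs
  have h2 : (n : ℝ) * ε ≤ ∑ y ∈ s, q y := by
    have := Finset.card_nsmul_le_sum s q ε hqs
    rwa [hcard, nsmul_eq_mul] at this
  rw [div_lt_iff₀ hε] at hn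
  linarith

/-- Testing `a` against its own residual `r = a - P_F a` gives `‖r‖² = ⟨a, r⟩ ≤ ε ‖r‖`, so `A` lies
within `ε` of a compact ball of `F`. -/
theorem totallyBounded_of_forall_orthogonal_le {A : Set H} {R : ℝ} (hR : ∀ a ∈ A, ‖a‖ ≤ R)
    (h : ∀ ε > 0, ∃ F : Submodule ℂ H, FiniteDimensional ℂ F ∧
      ∀ a ∈ A, ∀ y ∈ Fᗮ, ‖(inner ℂ a y : ℂ)‖ ≤ ε * ‖y‖) :
    TotallyBounded A := by
  refine totallyBounded_of_forall_exists_totallyBounded fun ε hε => ?_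
  obtain ⟨F, hF, hA⟩ := h ε hε
  refine ⟨((↑) : F → H) '' Metric.closedBall 0 R, ?_, fun a ha => ?_⟩
  · have : ProperSpace F := FiniteDimensional.proper ℂ F
    exact ((isCompact_closedBall (0 : F) R).image continuous_subtype_val).totallyBounded
  · refine ⟨F.starProjection a, ⟨⟨F.starProjection a, F.starProjection_apply_mem a⟩, ?_, rfl⟩, ?_⟩
    · rw [mem_closedBall_zero_iff]
      exact (F.norm_starProjection_apply_le a).trans (hR a ha)
    · set r := a - F.starProjection a with hr
      have hrF : r ∈ Fᗮ := F.sub_starProjection_mem_orthogonal a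
      have h1 := hA a ha r hrF
      have h2 : (inner ℂ a r : ℂ) = ((‖r‖ ^ 2 : ℝ) : ℂ) := by
        have h3 : a = F.starProjection a + r := by rw [hr]; abel
        conv_lhs => rw [h3]
        rw [inner_add_left, (Submodule.mem_orthogonal _ _).mp hrF _ (F.starProjection_apply_mem a),
          zero_add, inner_self_eq_norm_sq_to_K]
        norm_cast
      rw [h2, Complex.norm_real, Real.norm_of_nonneg (by positivity)] at h1
      rw [dist_eq_norm, ← hr]
      by_contra! hlt
      nlinarith [norm_nonneg r]

end Hilbert

/-! ### Averaged squared correlations along a strip. -/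

/-- Offsets add, so the shifted strip lies in the strip of double width, and only `|h.1|` columns
beyond each end can stick out. The error does not depend on `k` and disappears after division by
`k`. -/
theorem sum_stripFinset_translate_le {β b : ℝ} (hb : 0 < b) {h : ℤ × ℤ}
    (hh : h ∈ directionStrip β b) {φ : ℤ × ℤ → ℝ} {K : ℝ} (h0 : ∀ g, 0 ≤ φ g) (hK : ∀ g, φ g ≤ K)
    (k : ℕ) :
    ∑ g ∈ stripFinset β b (Finset.Ico 0 (k : ℤ)), φ (g + h) ≤
      ∑ g ∈ stripFinset β (b + b) (Finset.Ico 0 (k : ℤ)), φ g +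
        (b + b + 1) * (2 * h.1.natAbs) * K := by
  classical
  set N := h.1.natAbs with hN
  set A := stripFinset β (b + b) (Finset.Ico 0 (k : ℤ)) with hA
  set S : Finset ℤ := Finset.Ico (-(N : ℤ)) 0 ∪ Finset.Ico (k : ℤ) (k + N) with hS
  have hK0 : 0 ≤ K := (h0 0).trans (hK 0)
  have hcard : (S.card : ℝ) ≤ 2 * N := by
    have := Finset.card_union_le (Finset.Ico (-(N : ℤ)) 0) (Finset.Ico (k : ℤ) (k + N))
    rw [← hS, Int.card_Ico, Int.card_Ico] at this
    have h2 : S.card ≤ 2 * N := by omega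
    exact_mod_cast h2
  calc ∑ g ∈ stripFinset β b (Finset.Ico 0 (k : ℤ)), φ (g + h)
      = ∑ g ∈ (stripFinset β b (Finset.Ico 0 (k : ℤ))).image (· + h), φ g :=
        (Finset.sum_image fun _ _ _ _ h => add_right_cancel h).symm
    _ ≤ ∑ g ∈ A ∪ stripFinset β (b + b) S, φ g := by
        refine Finset.sum_le_sum_of_subset_of_nonneg (fun p hp => ?_) fun g _ _ => h0 g
        obtain ⟨g, hg, rfl⟩ := Finset.mem_image.mp hp
        rw [mem_stripFinset, Finset.mem_Ico] at hg
        have h1 := add_mem_directionStrip hg.1 hh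
        simp only [hA, hS, Finset.mem_union, mem_stripFinset, Finset.mem_Ico, Prod.fst_add]
        by_cases h2 : 0 ≤ g.1 + h.1 ∧ g.1 + h.1 < k
        · exact Or.inl ⟨h1, h2⟩
        · exact Or.inr ⟨h1, by omega⟩
    _ ≤ ∑ g ∈ A, φ g + ∑ g ∈ stripFinset β (b + b) S, φ g := by
        rw [← Finset.sum_union_inter]
        exact le_add_of_nonneg_right (Finset.sum_nonneg fun g _ => h0 g)
    _ ≤ ∑ g ∈ A, φ g + (b + b + 1) * (2 * N) * K := by
        gcongr
        refine (Finset.sum_le_card_nsmul _ _ K fun g _ => hK g).trans ?_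
        rw [nsmul_eq_mul]
        gcongr
        exact (card_stripFinset_le (by linarith) S).trans (by gcongr)

section Hilbert

variable {H : Type*} [NormedAddCommGroup H] [InnerProductSpace ℂ H]

/-- The orbit of `v` along a strip is totally bounded independently of the width. -/
theorem totallyBounded_orbit_strip {U : ℤ × ℤ → H →ₗᵢ[ℂ] H}
    (hU : ∀ g h x, U (g + h) x = U g (U h x)) {β a : ℝ} (b : ℝ) (ha : 0 < a) {v : H}
    (hv : TotallyBounded ((fun g => U g v) '' directionStrip β a)) :
    TotallyBounded ((fun g => U g v) '' directionStrip β b) := by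
  obtain ⟨F, hF⟩ := exists_finset_translates_cover β b ha
  have h1 : TotallyBounded (⋃ f ∈ (F : Set (ℤ × ℤ)),
      U f '' ((fun g => U g v) '' directionStrip β a)) :=
    (totallyBounded_biUnion F.finite_toSet).mpr fun f _ =>
      hv.image (U f).isometry.uniformContinuous
  refine h1.subset ?_
  rintro _ ⟨p, hp, rfl⟩
  obtain ⟨f, hf, hpf⟩ := hF p hp
  simp only [Set.mem_iUnion]
  exact ⟨f, hf, _, ⟨p - f, hpf, rfl⟩, by rw [← hU, add_sub_cancel]⟩

theorem inner_isometry_action_left {U : ℤ × ℤ → H →ₗᵢ[ℂ] H} (hU0 : ∀ x, U 0 x = x)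
    (hU : ∀ g h x, U (g + h) x = U g (U h x)) (g : ℤ × ℤ) (x y : H) :
    inner ℂ (U g x) y = inner ℂ x (U (-g) y) := by
  rw [← (U (-g)).inner_map_map (U g x) y, ← hU, neg_add_cancel, hU0]

theorem norm_average_mul_sq_le {ι : Type*} (s : Finset ι) (r : ℝ) (hr : 0 ≤ r) (x y : ι → ℂ) :
    ‖(r : ℂ) * ∑ i ∈ s, x i * y i‖ ^ 2 ≤
      (r * ∑ i ∈ s, ‖x i‖ ^ 2) * (r * ∑ i ∈ s, ‖y i‖ ^ 2) := by
  have h1 : ‖∑ i ∈ s, x i * y i‖ ≤ ∑ i ∈ s, ‖x i‖ * ‖y i‖ :=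
    (norm_sum_le _ _).trans_eq (Finset.sum_congr rfl fun i _ => norm_mul _ _)
  have h2 := Finset.sum_mul_sq_le_sq_mul_sq s (fun i => ‖x i‖) (fun i => ‖y i‖)
  have h3 : ‖∑ i ∈ s, x i * y i‖ ^ 2 ≤ (∑ i ∈ s, ‖x i‖ * ‖y i‖) ^ 2 := by gcongr
  rw [norm_mul, Complex.norm_real, Real.norm_of_nonneg hr]
  nlinarith [mul_le_mul_of_nonneg_left (h3.trans h2) (mul_nonneg hr hr)]

/-- If `f` is orthogonal to every vector with totally bounded orbit along a strip, the squared
correlations of its orbit with any vector average to zero along the strip. -/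
theorem tendsto_average_inner_sq_zero [CompleteSpace H] {U : ℤ × ℤ → H →ₗᵢ[ℂ] H}
    (hU0 : ∀ x, U 0 x = x) (hU : ∀ g h x, U (g + h) x = U g (U h x)) {β b : ℝ} (hb : 0 < b)
    {f : H}
    (hf : ∀ v, TotallyBounded ((fun g => U g v) '' directionStrip β b) → inner ℂ f v = 0)
    (ψ : H) :
    Tendsto (fun k : ℕ => (k : ℝ)⁻¹ *
      ∑ g ∈ stripFinset β b (Finset.Ico 0 (k : ℤ)), ‖(inner ℂ ψ (U g f) : ℂ)‖ ^ 2) atTop (𝓝 0) := by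
  -- Along an ultrafilter all bounded averages converge, so no subsequences are needed.
  rw [tendsto_iff_ultrafilter]
  intro 𝒰 h𝒰
  set E : ℝ → ℕ → Finset (ℤ × ℤ) := fun c k => stripFinset β c (Finset.Ico 0 (k : ℤ)) with hE
  have hinner : ∀ (x : H) g, ‖(inner ℂ x (U g f) : ℂ)‖ ^ 2 ≤ (‖x‖ * ‖f‖) ^ 2 := by
    intro x g
    gcongr
    exact (norm_inner_le_norm _ _).trans_eq (by rw [(U g).norm_map])
  have havg : ∀ {c : ℝ}, 0 < c → ∀ (k : ℕ) (φ : ℤ × ℤ → ℝ) (K : ℝ), 0 ≤ K → (∀ g, φ g ≤ K) →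
      (k : ℝ)⁻¹ * ∑ g ∈ E c k, φ g ≤ (c + 1) * K := by
    intro c hc k φ K hK hφ
    have h1 : ∑ g ∈ E c k, φ g ≤ (c + 1) * k * K := by
      refine (Finset.sum_le_card_nsmul _ _ K fun g _ => hφ g).trans ?_
      rw [nsmul_eq_mul]
      gcongr
      exact card_stripFinset_Ico_le hc k
    calc (k : ℝ)⁻¹ * ∑ g ∈ E c k, φ g ≤ (k : ℝ)⁻¹ * ((c + 1) * k * K) := by gcongr
      _ = (k : ℝ)⁻¹ * k * ((c + 1) * K) := by ring
      _ ≤ 1 * ((c + 1) * K) := by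
        gcongr
        exact inv_mul_le_one
      _ = (c + 1) * K := one_mul _
  set v : ℕ → H := fun k => ((k : ℝ)⁻¹ : ℝ) • ∑ g ∈ E b k, (inner ℂ (U g f) ψ : ℂ) • U g f with hv
  have hvin : ∀ k y, inner ℂ (v k) y =
      (((k : ℝ)⁻¹ : ℝ) : ℂ) * ∑ g ∈ E b k, inner ℂ ψ (U g f) * inner ℂ (U g f) y := by
    intro k y
    rw [hv]
    simp only
    rw [← Complex.coe_smul, inner_smul_left, sum_inner, Complex.conj_ofReal]
    simp only [inner_smul_left, inner_conj_symm]
  have hvb : ∀ k, ‖v k‖ ≤ (b + 1) * (‖f‖ * ‖ψ‖ * ‖f‖) := by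
    intro k
    refine le_trans ?_ (havg hb k (fun _ => ‖f‖ * ‖ψ‖ * ‖f‖) _ (by positivity) fun _ => le_rfl)
    rw [hv]
    simp only
    rw [norm_smul, Real.norm_of_nonneg (by positivity)]
    gcongr
    refine (norm_sum_le _ _).trans (Finset.sum_le_sum fun g _ => ?_)
    rw [norm_smul, (U g).norm_map]
    gcongr
    exact (norm_inner_le_norm _ _).trans_eq (by rw [(U g).norm_map])
  obtain ⟨w, hw⟩ := exists_weak_limit_ultrafilter 𝒰 v hvb
  have hbb : 0 < b + b := by linarith
  -- The double width leaves room for translation by any `h` in the strip.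
  have hqex : ∀ y : H, ∃ l : ℝ, Tendsto (fun k : ℕ => (k : ℝ)⁻¹ *
      ∑ g ∈ E (b + b) k, ‖(inner ℂ y (U g f) : ℂ)‖ ^ 2) 𝒰 (𝓝 l) := by
    intro y
    obtain ⟨l, -, hl⟩ := (isCompact_Icc (a := (0 : ℝ))
      (b := (b + b + 1) * (‖y‖ * ‖f‖) ^ 2)).ultrafilter_le_nhds
        (𝒰.map fun k : ℕ => (k : ℝ)⁻¹ * ∑ g ∈ E (b + b) k, ‖(inner ℂ y (U g f) : ℂ)‖ ^ 2)
        (le_principal_iff.mpr (Filter.mem_map.mpr (Filter.univ_mem' fun k =>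
          ⟨by positivity, havg hbb k _ _ (by positivity) (hinner y)⟩)))
    exact ⟨l, hl⟩
  choose q hq using hqex
  have hqhom : ∀ (c : ℂ) (y : H), q (c • y) = ‖c‖ ^ 2 * q y := by
    intro c y
    refine tendsto_nhds_unique (hq (c • y)) (((hq y).const_mul (‖c‖ ^ 2)).congr fun k => ?_)
    simp only [inner_smul_left, norm_mul, RCLike.norm_conj, mul_pow, ← Finset.mul_sum]
    ring
  -- Bessel's inequality is applied to each `U g f` before averaging.
  have hqtrace : ∀ s : Finset H, Orthonormal ℂ ((↑) : s → H) →
      ∑ y ∈ s, q y ≤ (b + b + 1) * ‖f‖ ^ 2 := by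
    intro s hs
    refine le_of_tendsto' (tendsto_finsetSum s fun y _ => hq y) fun k => ?_
    rw [← Finset.mul_sum, Finset.sum_comm]
    refine havg hbb k _ _ (by positivity) fun g => ?_
    have h1 := hs.sum_inner_products_le (U g f) (s := Finset.univ)
    rw [(U g).norm_map] at h1
    rwa [← Finset.sum_coe_sort s fun y => ‖(inner ℂ y (U g f) : ℂ)‖ ^ 2]
  have hinv : Tendsto (fun k : ℕ => (k : ℝ)⁻¹) 𝒰 (𝓝 0) :=
    tendsto_inv_atTop_nhds_zero_nat.mono_left h𝒰
  set C : ℝ := (b + 1) * (‖ψ‖ * ‖f‖) ^ 2 with hC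
  have hC0 : 0 ≤ C := by positivity
  -- The bound is uniform in `h`: Cauchy–Schwarz separates a factor in `ψ`, at most `C`, from a
  -- translated average in `y`, whose limit is at most `q y`.
  have key : ∀ h ∈ directionStrip β b, ∀ y, ‖(inner ℂ (U h w) y : ℂ)‖ ^ 2 ≤ C * q y := by
    intro h hh y
    rw [inner_isometry_action_left hU0 hU]
    set K : ℝ := (b + b + 1) * (2 * h.1.natAbs) * (‖y‖ * ‖f‖) ^ 2 with hK
    have hlim : Tendsto (fun k : ℕ => C * ((k : ℝ)⁻¹ *
        ∑ g ∈ E (b + b) k, ‖(inner ℂ y (U g f) : ℂ)‖ ^ 2 + (k : ℝ)⁻¹ * K)) 𝒰 (𝓝 (C * q y)) := by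
      have := ((hq y).add (hinv.mul_const K)).const_mul C
      rwa [zero_mul, add_zero] at this
    refine le_of_tendsto_of_tendsto' ((hw (U (-h) y)).norm.pow 2) hlim fun k => ?_
    rw [hvin]
    refine (norm_average_mul_sq_le _ _ (by positivity) _ _).trans ?_
    refine mul_le_mul (havg hb k _ _ (by positivity) (hinner ψ)) ?_ (by positivity) hC0
    rw [← mul_add]
    refine mul_le_mul_of_nonneg_left ?_ (by positivity)
    refine le_trans (le_of_eq (Finset.sum_congr rfl fun g _ => ?_))
      (sum_stripFinset_translate_le hb hh (fun g => by positivity) (hinner y) k)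
    rw [norm_inner_symm, inner_isometry_action_left hU0 hU (-h), neg_neg, ← hU, add_comm h g]
  have hwTB : TotallyBounded ((fun g => U g w) '' directionStrip β b) := by
    refine totallyBounded_of_forall_orthogonal_le (R := ‖w‖) ?_ fun ε hε => ?_
    · rintro _ ⟨g, -, rfl⟩
      exact ((U g).norm_map w).le
    -- Dividing by `C + 1` rather than `C` covers `C = 0`.
    · obtain ⟨F, hF, hqF⟩ := exists_finiteDimensional_forall_orthogonal_le q hqhom hqtrace
        (ε := ε ^ 2 / (C + 1)) (by positivity)
      refine ⟨F, hF, ?_⟩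
      rintro _ ⟨g, hg, rfl⟩ y hy
      refine le_of_sq_le_sq ?_ (by positivity)
      refine (key g hg y).trans ?_
      calc C * q y ≤ C * (ε ^ 2 / (C + 1) * ‖y‖ ^ 2) := by gcongr; exact hqF y hy
        _ = (C / (C + 1)) * (ε * ‖y‖) ^ 2 := by ring
        _ ≤ 1 * (ε * ‖y‖) ^ 2 := by
          gcongr
          exact div_le_one_of_le₀ (by linarith) (by linarith)
        _ = (ε * ‖y‖) ^ 2 := one_mul _
  -- Since the action is commutative, the strip orbit of `U (-g) w` is an isometric image of that of
  -- `w`, for any `g`.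
  have horth : ∀ g, inner ℂ (U g f) w = 0 := by
    intro g
    rw [inner_isometry_action_left hU0 hU]
    refine hf _ ((hwTB.image (U (-g)).isometry.uniformContinuous).subset ?_)
    rintro _ ⟨h, hh, rfl⟩
    exact ⟨U h w, ⟨h, hh, rfl⟩, by simp only [← hU, add_comm]⟩
  have hw0 : w = 0 := by
    have h1 : Tendsto (fun k => inner ℂ (v k) w) 𝒰 (𝓝 0) := by
      refine tendsto_const_nhds.congr fun k => ?_
      rw [hvin]
      simp [horth]
    exact inner_self_eq_zero.mp (tendsto_nhds_unique (hw w) h1)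
  have h1 := (hw ψ).norm
  rw [hw0, inner_zero_left, norm_zero] at h1
  refine h1.congr fun k => ?_
  rw [hvin, norm_mul, Complex.norm_real, Real.norm_of_nonneg (by positivity)]
  congr 1
  have h2 : ∑ g ∈ E b k, (inner ℂ ψ (U g f) : ℂ) * inner ℂ (U g f) ψ =
      ((∑ g ∈ E b k, ‖(inner ℂ ψ (U g f) : ℂ)‖ ^ 2 : ℝ) : ℂ) := by
    push_cast
    refine Finset.sum_congr rfl fun g _ => ?_
    rw [← inner_conj_symm (U g f) ψ, RCLike.mul_conj]
    norm_cast
  rw [h2, Complex.norm_real, Real.norm_of_nonneg (by positivity)]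

end Hilbert

/-! ### Density one along strips. -/

/-- The majorant is the supremum of the tail; the summand `1 / (k + 1)` makes it strictly positive,
so that its square root can be cancelled later. -/
theorem exists_antitone_majorant_tendsto_zero {u : ℕ → ℝ} (hu : Tendsto u atTop (𝓝 0)) :
    ∃ r : ℕ → ℝ, Antitone r ∧ (∀ k, 0 < r k) ∧ (∀ k, u k ≤ r k) ∧ Tendsto r atTop (𝓝 0) := by
  have hbdd : ∀ k, BddAbove (Set.range fun j => |u (j + k)|) := fun k =>
    (((tendsto_add_atTop_iff_nat k).mpr hu).abs).bddAbove_range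
  have hle : ∀ k j, |u (j + k)| ≤ ⨆ i, |u (i + k)| := fun k j => le_ciSup (hbdd k) j
  refine ⟨fun k => (⨆ j, |u (j + k)|) + 1 / ((k : ℝ) + 1), ?_, ?_, ?_, ?_⟩
  · intro k l hkl
    refine add_le_add (ciSup_le fun j => ?_) (Nat.one_div_le_one_div hkl)
    have h1 := hle k (j + (l - k))
    rwa [add_assoc, Nat.sub_add_cancel hkl] at h1
  · intro k
    exact add_pos_of_nonneg_of_pos ((abs_nonneg _).trans (hle k 0)) Nat.one_div_pos_of_nat
  · intro k
    have h1 := hle k 0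
    rw [zero_add] at h1
    linarith [le_abs_self (u k), Nat.one_div_pos_of_nat (α := ℝ) (n := k)]
  · have h1 : Tendsto (fun k => ⨆ j, |u (j + k)|) atTop (𝓝 0) := by
      rw [Metric.tendsto_atTop] at hu ⊢
      intro ε hε
      obtain ⟨N, hN⟩ := hu (ε / 2) (half_pos hε)
      refine ⟨N, fun k hk => ?_⟩
      have h2 : (⨆ j, |u (j + k)|) ≤ ε / 2 := ciSup_le fun j => by
        have := hN (j + k) (by omega)
        rw [Real.dist_eq, sub_zero] at this
        exact this.le
      rw [Real.dist_eq, sub_zero, abs_of_nonneg ((abs_nonneg _).trans (hle k 0))]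
      linarith
    simpa using h1.add (tendsto_one_div_add_atTop_nhds_zero_nat (𝕜 := ℝ))

theorem ncard_inter_verticalBand {β b : ℝ} {Q : Set (ℤ × ℤ)} (hQ : Q ⊆ directionStrip β b)
    [DecidablePred (· ∈ Q)] (k : ℕ) :
    (Q ∩ verticalBand k).ncard =
      ((stripFinset β b (Finset.Ico 0 (k : ℤ))).filter (· ∈ Q)).card := by
  rw [← Set.ncard_coe_finset]
  congr 1
  rw [Finset.coe_filter]
  ext p
  have h1 := Set.ext_iff.mp (coe_stripFinset_Ico β b k) p
  rw [Finset.mem_coe, directionStripTrunc, Set.mem_inter_iff] at h1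
  simp only [Set.mem_inter_iff, Set.mem_ofPred_eq, h1]
  exact ⟨fun h => ⟨⟨hQ h.1, h.2⟩, h.1⟩, fun h => ⟨h.2, h.1.2⟩⟩

theorem tendsto_card_stripFinset_atTop (β : ℝ) {b : ℝ} (hb : 0 < b) :
    Tendsto (fun k : ℕ => ((stripFinset β b (Finset.Ico 0 (k : ℤ))).card : ℝ)) atTop atTop := by
  obtain ⟨c, hc, hck⟩ := exists_linear_le_card_stripFinset β hb
  exact tendsto_atTop_mono' _ hck (tendsto_natCast_atTop_atTop.const_mul_atTop hc)

theorem tendsto_fst_atTop_of_injective {β b : ℝ} {s : ℕ → ℤ × ℤ}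
    (hs : ∀ i, s i ∈ directionStrip β b) (h0 : ∀ i, 0 ≤ (s i).1) (hinj : Function.Injective s) :
    Tendsto (fun i => (s i).1) atTop atTop := by
  rw [← Nat.cofinite_eq_atTop, tendsto_atTop]
  intro M
  rw [eventually_cofinite]
  refine Set.Finite.of_finite_image
    ((stripFinset β b (Finset.Ico 0 M)).finite_toSet.subset ?_) hinj.injOn
  rintro _ ⟨i, hi, rfl⟩
  rw [Finset.mem_coe, mem_stripFinset, Finset.mem_Ico]
  exact ⟨hs i, h0 i, not_le.mp hi⟩

/-- A Koopman-von Neumann lemma along strips. -/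
theorem exists_stripDensityOne_tendsto_zero {β b : ℝ} (hb : 0 < b) {α : ℤ × ℤ → ℝ}
    (hα : ∀ g, 0 ≤ α g)
    (havg : Tendsto (fun k : ℕ => (k : ℝ)⁻¹ *
      ∑ g ∈ stripFinset β b (Finset.Ico 0 (k : ℤ)), α g) atTop (𝓝 0)) :
    ∃ Q ⊆ directionStrip β b, HasStripDensityOne β b Q ∧
      ∀ s : ℕ → ℤ × ℤ, (∀ i, s i ∈ Q) → Function.Injective s →
        Tendsto (fun i => α (s i)) atTop (𝓝 0) := by
  classical
  obtain ⟨r, hanti, hpos, hur, hr⟩ := exists_antitone_majorant_tendsto_zero havg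
  obtain ⟨c, hc, hck⟩ := exists_linear_le_card_stripFinset β hb
  set E : ℕ → Finset (ℤ × ℤ) := fun k => stripFinset β b (Finset.Ico 0 (k : ℤ)) with hE
  have hsqrt : Tendsto (fun k => √(r k)) atTop (𝓝 0) := by
    simpa [Function.comp_def] using (Real.continuous_sqrt.tendsto 0).comp hr
  -- Column `m` first enters `E k` at `k = m + 1`; monotonicity of `r` then makes every bad point of
  -- `E k` satisfy `α > √(r k)`.
  set Q : Set (ℤ × ℤ) :=
    {p | p ∈ directionStrip β b ∧ 0 ≤ p.1 ∧ α p ≤ √(r (p.1.toNat + 1))} with hQ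
  have hQs : Q ⊆ directionStrip β b := fun p hp => hp.1
  refine ⟨Q, hQs, ?_, fun s hs hinj => ?_⟩
  -- Chebyshev: the bad count times `√(r k)` is at most `∑ α ≤ k * r k`.
  · have hbad : ∀ k : ℕ, (((E k).filter fun g => g ∉ Q).card : ℝ) ≤ k * √(r k) := by
      intro k
      have h1 : (((E k).filter fun g => g ∉ Q).card : ℝ) * √(r k) ≤ ∑ g ∈ E k, α g := by
        rw [← nsmul_eq_mul]
        refine (Finset.card_nsmul_le_sum _ α _ fun g hg => ?_).trans
          (Finset.sum_le_sum_of_subset_of_nonneg (Finset.filter_subset _ _) fun g _ _ => hα g)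
        obtain ⟨hgE, hgQ⟩ := Finset.mem_filter.mp hg
        obtain ⟨hgs, hgk⟩ := mem_stripFinset.mp hgE
        rw [Finset.mem_Ico] at hgk
        have h2 : √(r (g.1.toNat + 1)) < α g := by
          by_contra! h3
          exact hgQ ⟨hgs, hgk.1, h3⟩
        exact (Real.sqrt_le_sqrt (hanti (by omega))).trans h2.le
      rcases Nat.eq_zero_or_pos k with rfl | hk
      · simp [hE, stripFinset]
      have hk' : (0 : ℝ) < k := Nat.cast_pos.mpr hk
      have h3 := hur k
      rw [inv_mul_le_iff₀ hk'] at h3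
      have h4 := Real.sqrt_pos.mpr (hpos k)
      have h5 := Real.mul_self_sqrt (hpos k).le
      refine le_of_mul_le_mul_right ?_ h4
      rw [mul_assoc, h5]
      exact h1.trans h3
    have hlow : Tendsto (fun k => 1 - √(r k) / c) atTop (𝓝 1) := by
      simpa using (hsqrt.div_const c).const_sub 1
    refine tendsto_of_tendsto_of_tendsto_of_le_of_le' hlow tendsto_const_nhds ?_ ?_
    · filter_upwards [hck, eventually_gt_atTop 0] with k hk hk0
      have hk' : (0 : ℝ) < k := Nat.cast_pos.mpr hk0
      have hEpos : (0 : ℝ) < (E k).card := lt_of_lt_of_le (by positivity) hk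
      rw [ncard_inter_verticalBand hQs, ncard_directionStripTrunc, le_div_iff₀ hEpos]
      have h1 := Finset.card_filter_add_card_filter_not (s := E k) (· ∈ Q)
      have h2 : ((((E k).filter (· ∈ Q)).card : ℝ) + ((E k).filter fun g => g ∉ Q).card) =
          (E k).card := by exact_mod_cast h1
      have h3 : (k : ℝ) * √(r k) ≤ √(r k) / c * (E k).card := by
        rw [div_mul_eq_mul_div, le_div_iff₀ hc]
        nlinarith [Real.sqrt_nonneg (r k)]
      have h4 := hbad k
      change (1 - √(r k) / c) * ((E k).card : ℝ) ≤ ((E k).filter (· ∈ Q)).card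
      linarith
    · filter_upwards with k
      rw [ncard_inter_verticalBand hQs, ncard_directionStripTrunc]
      refine div_le_one_of_le₀ ?_ (Nat.cast_nonneg _)
      exact_mod_cast Finset.card_filter_le _ _
  · have h1 := tendsto_fst_atTop_of_injective (fun i => (hs i).1) (fun i => (hs i).2.1) hinj
    have h2 : Tendsto (fun i => (s i).1.toNat + 1) atTop atTop := by
      rw [tendsto_atTop] at h1 ⊢
      intro M
      filter_upwards [h1 M] with i hi
      omega
    exact squeeze_zero (fun i => hα _) (fun i => (hs i).2.2) (hsqrt.comp h2)

/-- If `α` tends to zero along a set of strip density one, it is rarely large in the strip. -/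
theorem tendsto_card_large_div_zero {β b : ℝ} (hb : 0 < b) {α : ℤ × ℤ → ℝ} {Q : Set (ℤ × ℤ)}
    (hQ : Q ⊆ directionStrip β b) (hd : HasStripDensityOne β b Q)
    (hα : ∀ s : ℕ → ℤ × ℤ, (∀ i, s i ∈ Q) → StrictMono (fun i => (s i).1) →
      Tendsto (fun i => α (s i)) atTop (𝓝 0)) {ε : ℝ} (hε : 0 < ε) :
    Tendsto (fun k : ℕ =>
      (((stripFinset β b (Finset.Ico 0 (k : ℤ))).filter fun g => ε ≤ α g).card : ℝ) /
        (stripFinset β b (Finset.Ico 0 (k : ℤ))).card) atTop (𝓝 0) := by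
  classical
  set E : ℕ → Finset (ℤ × ℤ) := fun k => stripFinset β b (Finset.Ico 0 (k : ℤ)) with hE
  -- Otherwise points of `Q` with `α ≥ ε` exist arbitrarily far right, and a recursive choice gives
  -- a sequence with strictly increasing first coordinates contradicting `hα`.
  obtain ⟨M, hM⟩ : ∃ M : ℤ, ∀ g ∈ Q, ε ≤ α g → g.1 < M := by
    by_contra! hcon
    choose G hGQ hGε hGM using hcon
    set s : ℕ → ℤ × ℤ := fun n => Nat.rec (G 0) (fun _ p => G (p.1 + 1)) n with hs
    have hsG : ∀ n, ∃ m, s n = G m := by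
      intro n
      cases n with
      | zero => exact ⟨_, rfl⟩
      | succ n => exact ⟨_, rfl⟩
    have h1 := hα s (fun n => by obtain ⟨m, hm⟩ := hsG n; rw [hm]; exact hGQ m)
      (strictMono_nat_of_lt_succ fun n => hGM ((s n).1 + 1))
    refine absurd (ge_of_tendsto' h1 fun n => ?_) (not_le.mpr hε)
    obtain ⟨m, hm⟩ := hsG n
    rw [hm]
    exact hGε m
  have hEtop := tendsto_card_stripFinset_atTop β hb
  set D : ℝ := ((stripFinset β b (Finset.Ico 0 M)).card : ℝ) with hD
  have hlim : Tendsto (fun k : ℕ => 1 - ((Q ∩ verticalBand k).ncard : ℝ) /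
      (directionStripTrunc β b k).ncard + D / (E k).card) atTop (𝓝 0) := by
    have h1 : Tendsto (fun k : ℕ => D / ((E k).card : ℝ)) atTop (𝓝 0) := hEtop.const_div_atTop D
    simpa using (Tendsto.const_sub 1 hd).add h1
  refine squeeze_zero' (Eventually.of_forall fun k => by positivity) ?_ hlim
  filter_upwards [hEtop.eventually_gt_atTop 0] with k hk
  rw [ncard_inter_verticalBand hQ, ncard_directionStripTrunc]
  have hsub : (E k).filter (fun g => ε ≤ α g) ⊆
      (E k).filter (fun g => g ∉ Q) ∪ stripFinset β b (Finset.Ico 0 M) := by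
    intro g hg
    obtain ⟨hgE, hgε⟩ := Finset.mem_filter.mp hg
    obtain ⟨hgs, hgk⟩ := mem_stripFinset.mp hgE
    rw [Finset.mem_union, Finset.mem_filter]
    by_cases hgQ : g ∈ Q
    · exact Or.inr (mem_stripFinset.mpr
        ⟨hgs, Finset.mem_Ico.mpr ⟨(Finset.mem_Ico.mp hgk).1, hM g hgQ hgε⟩⟩)
    · exact Or.inl ⟨hgE, hgQ⟩
  have h1 := (Finset.card_le_card hsub).trans (Finset.card_union_le _ _)
  have h2 := Finset.card_filter_add_card_filter_not (s := E k) (· ∈ Q)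
  have h3 : (((E k).filter fun g => ε ≤ α g).card : ℝ) ≤
      ((E k).filter fun g => g ∉ Q).card + D := by rw [hD]; exact_mod_cast h1
  have h4 : ((((E k).filter (· ∈ Q)).card : ℝ) + ((E k).filter fun g => g ∉ Q).card) =
      (E k).card := by exact_mod_cast h2
  change _ ≤ 1 - (((E k).filter (· ∈ Q)).card : ℝ) / (E k).card + D / (E k).card
  rw [div_le_iff₀ hk, add_mul, sub_mul, div_mul_cancel₀ _ hk.ne', div_mul_cancel₀ _ hk.ne']
  linarith

/-! ### The Koopman action and the directional Kronecker algebra. -/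

/-- The centred indicator of a set is orthogonal to the constants. -/
theorem inner_sub_const_const {X : Type*} [MeasurableSpace X] {μ : Measure X}
    [IsProbabilityMeasure μ] {B : Set X} (hB : MeasurableSet B) (c : ℂ) :
    inner ℂ (indicatorConstLp 2 hB (measure_ne_top μ B) (1 : ℂ) -
        ((μ.real B : ℝ) : ℂ) • Lp.const 2 μ 1) (Lp.const 2 μ c) = 0 := by
  have h1 : Lp.const 2 μ c = c • Lp.const 2 μ (1 : ℂ) := by
    refine Lp.ext ((Lp.coeFn_const 2 μ c).trans ?_)
    filter_upwards [Lp.coeFn_smul c (Lp.const 2 μ (1 : ℂ)), Lp.coeFn_const 2 μ (1 : ℂ)]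
      with x hx1 hx2
    rw [hx1, Pi.smul_apply, hx2]
    simp
  rw [h1, inner_smul_right, inner_sub_left, inner_smul_left, ← indicatorConstLp_univ,
    L2.inner_indicatorConstLp_one_indicatorConstLp_one,
    L2.inner_indicatorConstLp_one_indicatorConstLp_one]
  simp

section Koopman

variable {X : Type*} [MeasurableSpace X] [AddAction (ℤ × ℤ) X] [MeasurableConstVAdd (ℤ × ℤ) X]
  {μ : Measure X} [VAddInvariantMeasure (ℤ × ℤ) X μ]

theorem coeFn_koopman (g : ℤ × ℤ) (v : Lp ℂ 2 μ) :
    koopman μ g v =ᵐ[μ] fun x => v (g +ᵥ x) :=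
  Lp.coeFn_compMeasurePreserving v (measurePreserving_vadd g μ)

theorem koopman_zero (v : Lp ℂ 2 μ) : koopman μ 0 v = v := by
  refine Lp.ext ((coeFn_koopman 0 v).trans ?_)
  simp only [zero_vadd]
  rfl

theorem koopman_add (g h : ℤ × ℤ) (v : Lp ℂ 2 μ) :
    koopman μ (g + h) v = koopman μ g (koopman μ h v) := by
  refine Lp.ext ((coeFn_koopman _ v).trans ?_)
  have h1 := (measurePreserving_vadd g μ).quasiMeasurePreserving.ae_eq_comp (coeFn_koopman h v)
  filter_upwards [coeFn_koopman g (koopman μ h v), h1] with x hx hx1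
  rw [hx]
  simp only [Function.comp_apply] at hx1
  rw [hx1, vadd_vadd, add_comm]

theorem koopman_compLp (g : ℤ × ℤ) {F : ℂ → ℂ} {c : NNReal} (hF : LipschitzWith c F)
    (h0 : F 0 = 0) (v : Lp ℂ 2 μ) :
    koopman μ g (hF.compLp h0 v) = hF.compLp h0 (koopman μ g v) := by
  refine Lp.ext ((coeFn_koopman _ _).trans ?_)
  have h1 := (measurePreserving_vadd g μ).quasiMeasurePreserving.ae_eq_comp (hF.coeFn_compLp h0 v)
  filter_upwards [h1, hF.coeFn_compLp h0 (koopman μ g v), coeFn_koopman g v] with x hx1 hx2 hx3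
  rw [hx2, Function.comp_apply, hx3]
  exact hx1

theorem koopman_indicatorConstLp [IsFiniteMeasure μ] (g : ℤ × ℤ) {B : Set X}
    (hB : MeasurableSet B) :
    koopman μ g (indicatorConstLp 2 hB (measure_ne_top μ B) (1 : ℂ)) =
      indicatorConstLp 2 (hB.preimage (measurable_const_vadd g)) (measure_ne_top μ _) (1 : ℂ) :=
  rfl

theorem koopman_const [IsFiniteMeasure μ] (g : ℤ × ℤ) (c : ℂ) :
    koopman μ g (Lp.const 2 μ c) = Lp.const 2 μ c :=
  rfl

theorem mem_directionalKronecker_iff [IsFiniteMeasure μ] {β b : ℝ} {B : Set X}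
    (hB : MeasurableSet B) :
    B ∈ directionalKronecker μ β b ↔ TotallyBounded ((fun g : ℤ × ℤ =>
      koopman μ g (indicatorConstLp 2 hB (measure_ne_top μ B) (1 : ℂ))) '' directionStrip β b) := by
  rw [← isCompact_closure_iff_totallyBounded]
  exact ⟨fun ⟨_, h⟩ => h, fun h => ⟨hB, h⟩⟩

/-- The directional Kronecker algebra does not depend on the width of the strip. -/
theorem directionalKronecker_subset [IsFiniteMeasure μ] {β a : ℝ} (b : ℝ) (ha : 0 < a) :
    directionalKronecker μ β a ⊆ directionalKronecker μ β b := by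
  intro B hB
  obtain ⟨hBm, -⟩ := id hB
  rw [mem_directionalKronecker_iff hBm] at hB ⊢
  exact totallyBounded_orbit_strip koopman_add b ha hB

theorem totallyBounded_orbit_compLp {β b : ℝ} {F : ℂ → ℂ} {c : NNReal} (hF : LipschitzWith c F)
    (h0 : F 0 = 0) {v : Lp ℂ 2 μ}
    (hv : TotallyBounded ((fun g => koopman μ g v) '' directionStrip β b)) :
    TotallyBounded ((fun g => koopman μ g (hF.compLp h0 v)) '' directionStrip β b) := by
  refine (hv.image (hF.lipschitzWith_compLp h0).uniformContinuous).subset ?_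
  rintro _ ⟨g, hg, rfl⟩
  exact ⟨_, ⟨g, hg, rfl⟩, (koopman_compLp g hF h0 v).symm⟩

/-- Preimages of open sets avoiding the origin under functions with totally bounded orbit belong
to the directional Kronecker algebra. -/
theorem preimage_mem_directionalKronecker [IsFiniteMeasure μ] {β b : ℝ} {v : Lp ℂ 2 μ}
    (hv : TotallyBounded ((fun g => koopman μ g v) '' directionStrip β b)) {O : Set ℂ}
    (hO : IsOpen O) (h0 : (0 : ℂ) ∉ O) : v ⁻¹' O ∈ directionalKronecker μ β b := by
  have hvm : Measurable v := (Lp.stronglyMeasurable v).measurable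
  have hB : MeasurableSet (v ⁻¹' O) := hvm hO.measurableSet
  rw [mem_directionalKronecker_iff hB]
  set d : X → ℝ := fun x => Metric.infDist (v x) Oᶜ with hd
  have hdm : Measurable d := (Metric.continuous_infDist_pt _).measurable.comp hvm
  have hOc : Oᶜ.Nonempty := ⟨0, h0⟩
  have hdpos : ∀ x, 0 < d x ↔ x ∈ v ⁻¹' O := by
    intro x
    rw [← hO.isClosed_compl.notMem_iff_infDist_pos hOc, Set.notMem_compl_iff, Set.mem_preimage]
  -- Lipschitz approximations of the indicator of `O`. They vanish at `0` because `0 ∉ O`, as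
  -- composition in `Lp` requires, and composing with them preserves total boundedness of orbits.
  set F : ℕ → ℂ → ℂ := fun n z => ((min 1 (n * Metric.infDist z Oᶜ) : ℝ) : ℂ) with hF
  have hFlip : ∀ n : ℕ, LipschitzWith n (F n) := by
    intro n
    have h1 : LipschitzWith n fun z : ℂ => (n : ℝ) * Metric.infDist z Oᶜ := by
      refine LipschitzWith.of_dist_le_mul fun z z' => ?_
      rw [Real.dist_eq, ← mul_sub, abs_mul, Nat.abs_cast, NNReal.coe_natCast]
      gcongr
      simpa [Real.dist_eq] using (Metric.lipschitz_infDist_pt Oᶜ).dist_le_mul z z'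
    have h2 := Complex.isometry_ofReal.lipschitz.comp (h1.const_min 1)
    rwa [one_mul] at h2
  have hF0 : ∀ n, F n 0 = 0 := by
    intro n
    have : Metric.infDist (0 : ℂ) Oᶜ = 0 := Metric.infDist_zero_of_mem h0
    simp [hF, this]
  -- The set where `F n ∘ v` differs from the indicator of `v ⁻¹' O`; it decreases to the empty set.
  set D : ℕ → Set X := fun n => {x | 0 < d x ∧ (n : ℝ) * d x < 1} with hD
  have hDm : ∀ n, MeasurableSet (D n) := fun n =>
    (measurableSet_lt measurable_const hdm).inter
      (measurableSet_lt (hdm.const_mul _) measurable_const)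
  have hDlim : Tendsto (fun n => indicatorConstLp 2 (hDm n) (measure_ne_top μ _) (1 : ℂ)) atTop
      (𝓝 0) := by
    have h1 : Tendsto (fun n => μ (D n)) atTop (𝓝 0) := by
      have hanti : Antitone D := by
        intro n m hnm x hx
        refine ⟨hx.1, lt_of_le_of_lt ?_ hx.2⟩
        exact mul_le_mul_of_nonneg_right (Nat.cast_le.mpr hnm) hx.1.le
      have h2 := tendsto_measure_iInter_atTop (μ := μ) (fun n => (hDm n).nullMeasurableSet) hanti
        ⟨0, measure_ne_top μ _⟩
      have h3 : ⋂ n, D n = ∅ := by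
        rw [Set.eq_empty_iff_forall_notMem]
        intro x hx
        rw [Set.mem_iInter] at hx
        obtain ⟨n, hn⟩ := exists_nat_gt (1 / d x)
        have h4 := (hx n).2
        rw [div_lt_iff₀ (hx n).1] at hn
        linarith
      rwa [h3, measure_empty] at h2
    rw [← indicatorConstLp_empty (p := 2) (μ := μ) (c := (1 : ℂ))]
    refine tendsto_indicatorConstLp_set (by simp) ?_
    simpa only [← Set.bot_eq_empty, symmDiff_bot] using h1
  have hdist : ∀ n, ‖indicatorConstLp 2 hB (measure_ne_top μ _) (1 : ℂ) -
      (hFlip n).compLp (hF0 n) v‖ ≤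
        ‖indicatorConstLp 2 (hDm n) (measure_ne_top μ _) (1 : ℂ)‖ := by
    intro n
    refine Lp.norm_le_norm_of_ae_le ?_
    filter_upwards [Lp.coeFn_sub (indicatorConstLp 2 hB (measure_ne_top μ _) (1 : ℂ))
      ((hFlip n).compLp (hF0 n) v), (hFlip n).coeFn_compLp (hF0 n) v,
      indicatorConstLp_coeFn (p := 2) (hs := hB) (hμs := measure_ne_top μ _) (c := (1 : ℂ)),
      indicatorConstLp_coeFn (p := 2) (hs := hDm n) (hμs := measure_ne_top μ _) (c := (1 : ℂ))]
      with x h1 h2 h3 h4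
    rw [h1, Pi.sub_apply, h2, h3, h4, Function.comp_apply]
    have hFx : F n (v x) = ((min 1 (n * d x) : ℝ) : ℂ) := rfl
    rw [hFx]
    have hdnn : 0 ≤ d x := Metric.infDist_nonneg
    by_cases hx : x ∈ v ⁻¹' O
    · rw [Set.indicator_of_mem hx]
      by_cases hnx : (n : ℝ) * d x < 1
      · rw [Set.indicator_of_mem (show x ∈ D n from ⟨(hdpos x).mpr hx, hnx⟩), norm_one,
          min_eq_right hnx.le, ← Complex.ofReal_one, ← Complex.ofReal_sub, Complex.norm_real,
          Real.norm_of_nonneg (by linarith)]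
        have : 0 ≤ (n : ℝ) * d x := by positivity
        linarith
      · rw [min_eq_left (not_lt.mp hnx), Complex.ofReal_one, sub_self, norm_zero]
        exact norm_nonneg _
    · have hx0 : d x = 0 := le_antisymm (not_lt.mp fun h => hx ((hdpos x).mp h)) hdnn
      rw [Set.indicator_of_notMem hx, hx0]
      simp
  refine totallyBounded_of_forall_exists_totallyBounded fun ε hε => ?_
  obtain ⟨n, hn⟩ := ((tendsto_zero_iff_norm_tendsto_zero.mp hDlim).eventually_lt_const hε).exists
  refine ⟨_, totallyBounded_orbit_compLp (hFlip n) (hF0 n) hv, ?_⟩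
  rintro _ ⟨g, hg, rfl⟩
  refine ⟨_, ⟨g, hg, rfl⟩, ?_⟩
  rw [(koopman μ g).isometry.dist_eq, dist_eq_norm]
  exact (hdist n).trans hn.le

/-- Preimages under `v` of open sets avoiding `0` lie in the Kronecker algebra, so they are null or
conull. As open sets separate points of `ℂ` countably, `v` is almost everywhere constant. -/
theorem IsDirectionalWeakMixing.exists_eq_const [IsFiniteMeasure μ] {β a b : ℝ} (hb : 0 < b)
    (hmix : IsDirectionalWeakMixing μ β a) {v : Lp ℂ 2 μ}
    (hv : TotallyBounded ((fun g => koopman μ g v) '' directionStrip β b)) :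
    ∃ c : ℂ, v = Lp.const 2 μ c := by
  have key : ∀ O : Set ℂ, IsOpen O → (0 : ℂ) ∉ O →
      (∀ᵐ x ∂μ, v x ∈ O) ∨ (∀ᵐ x ∂μ, v x ∉ O) := by
    intro O hO h0
    rcases hmix _ (directionalKronecker_subset a hb
      (preimage_mem_directionalKronecker hv hO h0)) with h | h
    · exact Or.inr ((eventuallyEq_set.mp h).mono fun x hx => by simpa using hx)
    · exact Or.inl ((eventuallyEq_set.mp h).mono fun x hx => by simpa using hx)
  obtain ⟨c, hc⟩ : ∃ c : ℂ, v =ᵐ[μ] Function.const X c := by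
    refine exists_eventuallyEq_const_of_forall_separating IsOpen fun O hO => ?_
    -- An open set containing `0` is handled through `{0}ᶜ` and `O \ {0}`, both open and avoiding
    -- `0`.
    by_cases h0 : (0 : ℂ) ∈ O
    · rcases key {0}ᶜ isOpen_compl_singleton (by simp) with h1 | h1
      · rcases key (O \ {0}) (hO.sdiff isClosed_singleton) (by simp) with h2 | h2
        · exact Or.inl (h2.mono fun x hx => hx.1)
        · refine Or.inr ((h1.and h2).mono fun x hx hxO => hx.2 ⟨hxO, hx.1⟩)
      · refine Or.inl (h1.mono fun x hx => ?_)
        have : v x = 0 := by simpa using hx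
        rwa [this]
    · exact key O hO h0
  exact ⟨c, Lp.ext (hc.trans (Lp.coeFn_const 2 μ c).symm)⟩

/-! ### The two implications and the equivalence. -/

theorem inner_indicator_koopman_sub_const [IsProbabilityMeasure μ] {B C : Set X}
    (hB : MeasurableSet B) (hC : MeasurableSet C) (g : ℤ × ℤ) :
    inner ℂ (indicatorConstLp 2 hC (measure_ne_top μ C) (1 : ℂ))
      (koopman μ g (indicatorConstLp 2 hB (measure_ne_top μ B) (1 : ℂ) -
        ((μ.real B : ℝ) : ℂ) • Lp.const 2 μ 1)) =
      ((μ.real ((fun x => g +ᵥ x) ⁻¹' B ∩ C) - μ.real B * μ.real C : ℝ) : ℂ) := by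
  rw [map_sub, map_smul, koopman_const, koopman_indicatorConstLp, inner_sub_right,
    inner_smul_right, ← indicatorConstLp_univ,
    L2.inner_indicatorConstLp_one_indicatorConstLp_one,
    L2.inner_indicatorConstLp_one_indicatorConstLp_one, Set.inter_univ, Set.inter_comm]
  push_cast
  rfl

theorem IsDirectionalWeakMixing.exists_stripDensityOne_mixesAlong [IsProbabilityMeasure μ]
    {β a b : ℝ} (hb : 0 < b) (hmix : IsDirectionalWeakMixing μ β a) {B C : Set X}
    (hB : MeasurableSet B) (hC : MeasurableSet C) :
    ∃ Q ⊆ directionStrip β b, HasStripDensityOne β b Q ∧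
      ∀ s : ℕ → ℤ × ℤ, (∀ i, s i ∈ Q) → Function.Injective s → MixesAlong μ B C s := by
  have havg := tendsto_average_inner_sq_zero (U := koopman μ) koopman_zero koopman_add (β := β) hb
    (f := indicatorConstLp 2 hB (measure_ne_top μ B) (1 : ℂ) -
      ((μ.real B : ℝ) : ℂ) • Lp.const 2 μ 1)
    (fun v hv => by
      obtain ⟨c, rfl⟩ := hmix.exists_eq_const hb hv
      exact inner_sub_const_const hB c)
    (indicatorConstLp 2 hC (measure_ne_top μ C) (1 : ℂ))
  simp only [inner_indicator_koopman_sub_const hB hC, Complex.norm_real, Real.norm_eq_abs,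
    sq_abs] at havg
  obtain ⟨Q, hQ, hd, hs⟩ := exists_stripDensityOne_tendsto_zero hb (fun g => sq_nonneg _) havg
  refine ⟨Q, hQ, hd, fun s hsQ hinj => ?_⟩
  have h1 := (Real.continuous_sqrt.tendsto 0).comp (hs s hsQ hinj)
  simp only [Function.comp_def, Real.sqrt_sq_eq_abs, Real.sqrt_zero] at h1
  rw [MixesAlong, tendsto_iff_dist_tendsto_zero]
  exact h1

theorem isDirectionalWeakMixing_of_exists_mixesAlong [IsProbabilityMeasure μ] {β a b : ℝ}
    (ha : 0 < a) (hb : 0 < b)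
    (h : ∀ B C : Set X, MeasurableSet B → MeasurableSet C →
      ∃ Q ⊆ directionStrip β b, HasStripDensityOne β b Q ∧
        ∀ s : ℕ → ℤ × ℤ, (∀ i, s i ∈ Q) → StrictMono (fun i => (s i).1) → MixesAlong μ B C s) :
    IsDirectionalWeakMixing μ β a := by
  classical
  intro B hBa
  obtain ⟨hB, -⟩ := id hBa
  have hTB := (mem_directionalKronecker_iff hB).mp (directionalKronecker_subset b ha hBa)
  set f := indicatorConstLp 2 hB (measure_ne_top μ B) (1 : ℂ) with hf
  have hin : ∀ g₁ g₂ : ℤ × ℤ, inner ℂ (koopman μ g₁ f) (koopman μ g₂ f) =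
      ((μ.real ((fun x => g₂ +ᵥ x) ⁻¹' B ∩ (fun x => g₁ +ᵥ x) ⁻¹' B) : ℝ) : ℂ) := by
    intro g₁ g₂
    rw [hf, koopman_indicatorConstLp, koopman_indicatorConstLp,
      L2.inner_indicatorConstLp_one_indicatorConstLp_one, Set.inter_comm]
    rfl
  have hpre : ∀ g : ℤ × ℤ, μ.real ((fun x => g +ᵥ x) ⁻¹' B) = μ.real B := fun g =>
    (measurePreserving_vadd g μ).measureReal_preimage hB.nullMeasurableSet
  have hfn : ‖f‖ ≤ 1 := by
    have h1 : ‖f‖ ^ 2 = μ.real B := by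
      have h2 := hin 0 0
      rw [(koopman μ 0).inner_map_map, inner_self_eq_norm_sq_to_K, Set.inter_self, hpre] at h2
      exact Complex.ofReal_injective ((Complex.ofReal_pow _ _).trans h2)
    have h2 : μ.real B ≤ 1 := measureReal_le_one
    nlinarith [norm_nonneg f]
  -- Half of `ε` is spent on the distance to the net, half on the failure of independence.
  have key : ∀ ε > 0, |μ.real B - μ.real B * μ.real B| ≤ ε := by
    intro ε hε
    obtain ⟨t, hts, htfin, hcov⟩ :=
      Metric.finite_approx_of_totallyBounded hTB (ε / 2) (half_pos hε)
    have hbad : ∀ g₁ : ℤ × ℤ, Tendsto (fun k : ℕ =>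
        (((stripFinset β b (Finset.Ico 0 (k : ℤ))).filter fun g => ε / 2 ≤
          |μ.real ((fun x => g +ᵥ x) ⁻¹' B ∩ (fun x => g₁ +ᵥ x) ⁻¹' B) -
            μ.real B * μ.real B|).card : ℝ) /
          (stripFinset β b (Finset.Ico 0 (k : ℤ))).card) atTop (𝓝 0) := by
      intro g₁
      obtain ⟨Q, hQ, hd, hs⟩ := h B _ hB (hB.preimage (measurable_const_vadd g₁))
      refine tendsto_card_large_div_zero hb hQ hd (fun s hsQ hmono => ?_) (half_pos hε)
      have h1 := hs s hsQ hmono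
      rw [MixesAlong, tendsto_iff_dist_tendsto_zero] at h1
      simp only [Real.dist_eq] at h1
      rwa [show μ.real ((fun x => g₁ +ᵥ x) ⁻¹' B) = μ.real B from hpre g₁] at h1
    choose! γ hγ using fun y (hy : y ∈ t) => hts hy
    have hsum := tendsto_finsetSum htfin.toFinset fun y _ => hbad (γ y)
    rw [Finset.sum_const_zero] at hsum
    obtain ⟨k, hk1, hk2⟩ := ((hsum.eventually_lt_const one_pos).and
      ((tendsto_card_stripFinset_atTop β hb).eventually_gt_atTop 0)).exists
    rw [← Finset.sum_div, div_lt_one hk2] at hk1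
    -- The bad proportions for the finitely many net points sum to less than `1`, so some `g` is
    -- good for all of them at once.
    obtain ⟨g, hg, hgood⟩ : ∃ g ∈ stripFinset β b (Finset.Ico 0 (k : ℤ)), ∀ y ∈ t,
        |μ.real ((fun x => g +ᵥ x) ⁻¹' B ∩ (fun x => γ y +ᵥ x) ⁻¹' B) -
          μ.real B * μ.real B| < ε / 2 := by
      by_contra! hcon
      have hsub : stripFinset β b (Finset.Ico 0 (k : ℤ)) ⊆ htfin.toFinset.biUnion fun y =>
          (stripFinset β b (Finset.Ico 0 (k : ℤ))).filter fun g => ε / 2 ≤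
            |μ.real ((fun x => g +ᵥ x) ⁻¹' B ∩ (fun x => γ y +ᵥ x) ⁻¹' B) -
              μ.real B * μ.real B| := by
        intro g hg
        obtain ⟨y, hy, hgy⟩ := hcon g hg
        exact Finset.mem_biUnion.mpr
          ⟨y, htfin.mem_toFinset.mpr hy, Finset.mem_filter.mpr ⟨hg, hgy⟩⟩
      have h1 := (Finset.card_le_card hsub).trans Finset.card_biUnion_le
      refine absurd hk1 (not_lt.mpr ?_)
      exact_mod_cast h1
    have hgc := hcov ⟨g, (mem_stripFinset.mp hg).1, rfl⟩
    simp only [Set.mem_iUnion, Metric.mem_ball] at hgc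
    obtain ⟨y, hy, hgy⟩ := hgc
    have h1 := hgood y hy
    have hyy : koopman μ (γ y) f = y := (hγ y hy).2
    have h2 : |μ.real B - μ.real ((fun x => g +ᵥ x) ⁻¹' B ∩ (fun x => γ y +ᵥ x) ⁻¹' B)| ≤
        ε / 2 := by
      have h3 : inner ℂ (koopman μ (γ y) f) (koopman μ (γ y) f - koopman μ g f) =
          ((μ.real B - μ.real ((fun x => g +ᵥ x) ⁻¹' B ∩ (fun x => γ y +ᵥ x) ⁻¹' B) : ℝ) : ℂ) := by
        rw [inner_sub_right, hin, hin, Set.inter_self, hpre]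
        push_cast
        rfl
      rw [← Real.norm_eq_abs, ← Complex.norm_real, ← h3]
      refine (norm_inner_le_norm _ _).trans ?_
      rw [(koopman μ (γ y)).norm_map, hyy, ← dist_eq_norm, dist_comm]
      nlinarith [norm_nonneg f, dist_nonneg (x := koopman μ g f) (y := y)]
    have h3 := abs_add_le
      (μ.real B - μ.real ((fun x => g +ᵥ x) ⁻¹' B ∩ (fun x => γ y +ᵥ x) ⁻¹' B))
      (μ.real ((fun x => g +ᵥ x) ⁻¹' B ∩ (fun x => γ y +ᵥ x) ⁻¹' B) - μ.real B * μ.real B)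
    rw [sub_add_sub_cancel] at h3
    linarith
  have h0 : μ.real B * (1 - μ.real B) = 0 := by
    have h1 : |μ.real B - μ.real B * μ.real B| ≤ 0 := le_of_forall_pos_le_add fun ε hε => by
      rw [zero_add]
      exact key ε hε
    linarith [abs_nonpos_iff.mp h1]
  rcases mul_eq_zero.mp h0 with h1 | h1
  · left
    rw [measureReal_eq_zero_iff] at h1
    exact ae_eq_empty.mpr h1
  · right
    rw [ae_eq_univ, ← measureReal_eq_zero_iff, probReal_compl_eq_one_sub hB]
    exact h1

end Koopman

theorem mainTheorem9 {X : Type*} [MetricSpace X] [CompactSpace X]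
    [MeasurableSpace X] [BorelSpace X]
    [AddAction (ℤ × ℤ) X] [ContinuousConstVAdd (ℤ × ℤ) X]
    (μ : Measure X) [IsProbabilityMeasure μ] [VAddInvariantMeasure (ℤ × ℤ) X μ]
    (β : ℝ) (a b : ℝ) (ha : 0 < a) (hb : 0 < b) :
    List.TFAE [
      IsDirectionalWeakMixing μ β a,
      ∀ B C : Set X, MeasurableSet B → MeasurableSet C →
        ∃ Q ⊆ directionStrip β b, HasStripDensityOne β b Q ∧
          ∀ s : ℕ → ℤ × ℤ, (∀ i, s i ∈ Q) → StrictMono (fun i => (s i).1) →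
            MixesAlong μ B C s,
      ∀ B C : Set X, MeasurableSet B → MeasurableSet C →
        ∃ Q ⊆ directionStrip β b, HasStripDensityOne β b Q ∧
          ∀ s : ℕ → ℤ × ℤ, (∀ i, s i ∈ Q) → Function.Injective s →
            MixesAlong μ B C s] := by
  tfae_have 1 → 3 := fun h B C hB hC => h.exists_stripDensityOne_mixesAlong hb hB hC
  tfae_have 3 → 2 := by
    intro h B C hB hC
    obtain ⟨Q, hQ, hd, hs⟩ := h B C hB hC
    exact ⟨Q, hQ, hd, fun s hsQ hmono =>
      hs s hsQ (Function.Injective.of_comp (f := Prod.fst) hmono.injective)⟩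
  tfae_have 2 → 1 := isDirectionalWeakMixing_of_exists_mixesAlong ha hb
  tfae_finish
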